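/- **Proposition (Correlated Errors and Biases).** There are $I \ge 1$ individuals with true calibers $A=(A_1,\dots,A_I)\in\mathbb{R}^I$, and there are no groups. In periods $t=1,2,\dots$ agent $i$ observes the vector of recognitions $q_t = A + \epsilon_t \in\mathbb{R}^I$, where the errors $\epsilon_t$ are independent over time and normally distributed with mean zero and positive definite covariance matrix $\Sigma^q$. Agent $i$ is certain that his own caliber is $\tilde a_i > A_i$. His prior $\mathbf{P}_0$ is a Borel probability measure on $\mathbb{R}^I\times\{\text{positive definite } I\times I \text{ matrices}\}$ whose support in this space is $\{(a,\Sigma') : a_i=\tilde a_i\}$. He updates by Bayes' rule with the normal likelihood: after $t$ periods, the probability that he assigns to a measurable set $B$ is $$\mathbf{P}_t B = \frac{\int_B \ell_t \, d\mathbf{P}_0}{\int \ell_t\, d\mathbf{P}_0},\qquad \ell_t(a,\Sigma') = \prod_{z=1}^t \frac{1}{\sqrt{(2\pi)^I\det\Sigma'}}\exp\Big(-\tfrac12 (q_z-a)^T\Sigma'^{-1}(q_z-a)\Big).$$ His beliefs concentrate on a point $(\tilde a,\tilde\Sigma)$ if $\lim_{t\to\infty}\mathbf{P}_t B=1$ for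 every open set $B$ that contains the point. Then there is a point $(\tilde a^i,\tilde\Sigma^q)$ such that, almost surely, agent $i$'s beliefs concentrate on $(\tilde a^i,\tilde\Sigma^q)$ and on no other point. His long-run bias about any agent $j$ is $$\tilde a^i_j - A_j = \frac{\Sigma^q_{ij}}{\Sigma^q_{ii}}(\tilde a_i - A_i),$$ and his long-run bias about the covariance matrix is, for all $j,j'$, $$\tilde\Sigma^q_{jj'}-\Sigma^q_{jj'} = (\tilde a^i_j-A_j)(\tilde a^i_{j'}-A_{j'}) = \frac{\Sigma^q_{j'i}\,\Sigma^q_{ji}}{(\Sigma^q_{ii})^2}(\tilde a_i-A_i)^2 .$$ -/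

import Mathlib

open MeasureTheory ProbabilityTheory Filter Topology
open scoped ENNReal Matrix

namespace SocialBeliefs

/-- Real matrices carry their Borel σ-algebra (for the entrywise topology). -/
instance instMeasurableSpaceMatrix (n : ℕ) : MeasurableSpace (Matrix (Fin n) (Fin n) ℝ) :=
  borel _

instance instBorelSpaceMatrix (n : ℕ) : BorelSpace (Matrix (Fin n) (Fin n) ℝ) :=
  ⟨rfl⟩

/-- Positive definite (in particular symmetric) real `n × n` matrices, with the subspace topology
and its Borel σ-algebra. -/
abbrev CovMatrix (n : ℕ) : Type :=
  {S : Matrix (Fin n) (Fin n) ℝ // S.PosDef}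

/-- What the agent is uncertain about: the vector of calibers of the `n` individuals, and the
covariance matrix of the recognition errors. -/
abbrev Param (n : ℕ) : Type :=
  EuclideanSpace ℝ (Fin n) × CovMatrix n

/-- Recognition without groups: `q = a + ε`. -/
noncomputable def recognition {n : ℕ} (a ε : EuclideanSpace ℝ (Fin n)) :
    EuclideanSpace ℝ (Fin n) :=
  a + ε

/-- The density at `q` of the normal distribution with mean `p.1` and covariance matrix `p.2`. -/
noncomputable def density {n : ℕ} (q : EuclideanSpace ℝ (Fin n)) (p : Param n) : ℝ :=
  1 / Real.sqrt ((2 * Real.pi) ^ n * p.2.1.det) *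
    Real.exp (-(1 / 2) * ((q - p.1).ofLp ⬝ᵥ (p.2.1⁻¹ *ᵥ (q - p.1).ofLp)))

/-- The likelihood of the first `t` terms of the sequence `q` of observations. -/
noncomputable def likelihood {n : ℕ} (t : ℕ) (q : ℕ → EuclideanSpace ℝ (Fin n)) (p : Param n) :
    ℝ :=
  ∏ z ∈ Finset.range t, density (q z) p

/-- The posterior probability of `B` after the first `t` observations, by Bayes' rule. -/
noncomputable def posterior {n : ℕ} (P₀ : Measure (Param n)) (q : ℕ → EuclideanSpace ℝ (Fin n))
    (t : ℕ) (B : Set (Param n)) : ℝ≥0∞ :=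
  (∫⁻ p in B, ENNReal.ofReal (likelihood t q p) ∂P₀) /
    (∫⁻ p, ENNReal.ofReal (likelihood t q p) ∂P₀)

/-- Along the sequence `q` of observations, the beliefs concentrate on the point `p`: in the limit
every open set that contains `p` has posterior probability `1`. -/
def BeliefsConcentrateOn {n : ℕ} (P₀ : Measure (Param n)) (q : ℕ → EuclideanSpace ℝ (Fin n))
    (p : Param n) : Prop :=
  ∀ B : Set (Param n), IsOpen B → p ∈ B →
    Tendsto (fun t : ℕ => posterior P₀ q t B) atTop (𝓝 1)

/-- The prior is certain that agent `i` has caliber `ai`, and has full support with respect to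
the calibers of all others and the positive definite covariance matrices of the errors. -/
def IsStubbornPrior {n : ℕ} (P₀ : Measure (Param n)) (i : Fin n) (ai : ℝ) : Prop :=
  P₀.support = {p : Param n | p.1 i = ai}

end SocialBeliefs

/-! The normal likelihood of `t` observations depends on the data only through their mean and biased
covariance: it is `exp (-(t/2) * (const + crossEntropy moments p))` (`likelihood_eq_exp`). By the
strong law the moments tend almost surely to `(A, S)`, and from there on the argument is
deterministic: the posterior concentrates where `crossEntropy (A, S)` is least on the support `a_i =
ai` of the prior.

The minimiser is found in two stages. For a fixed mean `a` and `w = A - a`, the best covariance is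
`S + w wᵀ` (`log_det_add_le`), with value `log det S + log (1 + wᵀ S⁻¹ w) + n`. With `w_i` fixed,
Cauchy–Schwarz for `S⁻¹` makes `wᵀ S⁻¹ w` least exactly when `w` is a multiple of column `i` of `S`.
The two equality cases give uniqueness and the bias formulas.

The parameter space is not compact, so a unique minimiser alone is not enough. Coercivity, uniform
for moments near `(A, S)` (`exists_isCompact_forall_notMem_lt_crossEntropy`), yields a strict gap
away from the minimiser, and the gap makes the posterior mass there decay exponentially. -/

namespace SocialBeliefs

/-! ### Log-determinant against trace, and the optimal covariance matrix. -/

open scoped MatrixOrder Matrix.Norms.L2Operator in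
theorem exists_eq_transpose_mul_self {n : ℕ} {N : Matrix (Fin n) (Fin n) ℝ} (hN : N.PosSemidef) :
    ∃ B : Matrix (Fin n) (Fin n) ℝ, N = Bᵀ * B := by
  obtain ⟨y, hy⟩ := CStarAlgebra.nonneg_iff_eq_star_mul_self.mp hN.nonneg
  exact ⟨y, by rw [hy, Matrix.star_eq_conjTranspose, Matrix.conjTranspose_eq_transpose_of_trivial]⟩

/-- Sum `log x ≤ x - 1` over the eigenvalues. -/
theorem log_det_le_trace_sub {n : ℕ} {N : Matrix (Fin n) (Fin n) ℝ} (hN : N.PosDef) :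
    Real.log N.det ≤ N.trace - n := by
  rw [hN.1.det_eq_prod_eigenvalues, hN.1.trace_eq_sum_eigenvalues]
  simp only [RCLike.ofReal_real_eq_id, id]
  rw [Real.log_prod (fun i _ => (hN.eigenvalues_pos i).ne')]
  calc _ ≤ ∑ i, (hN.1.eigenvalues i - 1) :=
        Finset.sum_le_sum fun i _ => Real.log_le_sub_one_of_pos (hN.eigenvalues_pos i)
    _ = _ := by simp

theorem eq_one_of_log_det_eq {n : ℕ} {N : Matrix (Fin n) (Fin n) ℝ} (hN : N.PosDef)
    (h : Real.log N.det = N.trace - n) : N = 1 := by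
  have h1 : ∑ i, Real.log (hN.1.eigenvalues i) = ∑ i, (hN.1.eigenvalues i - 1) := by
    rw [hN.1.det_eq_prod_eigenvalues, hN.1.trace_eq_sum_eigenvalues] at h
    simp only [RCLike.ofReal_real_eq_id, id] at h
    rw [Real.log_prod (fun i _ => (hN.eigenvalues_pos i).ne')] at h
    rw [h]; simp
  have h2 := (Finset.sum_eq_sum_iff_of_le
    fun i _ => Real.log_le_sub_one_of_pos (hN.eigenvalues_pos i)).1 h1
  have h3 : hN.1.eigenvalues = fun _ => 1 := by
    funext i
    by_contra hne
    exact (Real.log_lt_sub_one_of_pos (hN.eigenvalues_pos i) hne).ne (h2 i (Finset.mem_univ i))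
  have h4 := hN.1.spectral_theorem
  rw [h3] at h4
  rw [h4]
  have : (Matrix.diagonal ((RCLike.ofReal : ℝ → ℝ) ∘ fun _ : Fin n => (1 : ℝ))) = 1 := by
    ext i j; simp [Matrix.diagonal, Matrix.one_apply]
  rw [this, map_one]

theorem posDef_mul_mul_transpose {n : ℕ} {M B : Matrix (Fin n) (Fin n) ℝ} (hM : M.PosDef)
    (hB : IsUnit B.det) : (B * M * Bᵀ).PosDef := by
  have := (Matrix.IsUnit.posDef_star_right_conjugate_iff (x := M)
    ((Matrix.isUnit_iff_isUnit_det B).2 hB)).2 hM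
  rwa [Matrix.star_eq_conjTranspose, Matrix.conjTranspose_eq_transpose_of_trivial] at this

/-- Congruence by `B` turns `V` into the identity, so comparing `V` with `M` reduces to the
eigenvalues of `B * M * Bᵀ`. -/
theorem exists_whitening {n : ℕ} {V : Matrix (Fin n) (Fin n) ℝ} (hV : V.PosDef) :
    ∃ B : Matrix (Fin n) (Fin n) ℝ, V⁻¹ = Bᵀ * B ∧ IsUnit B.det := by
  obtain ⟨B, hB⟩ := exists_eq_transpose_mul_self hV.inv.posSemidef
  refine ⟨B, hB, ?_⟩
  have h : V⁻¹.det ≠ 0 := hV.inv.det_pos.ne'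
  rw [hB, Matrix.det_mul] at h
  exact (right_ne_zero_of_mul h).isUnit

theorem log_det_whitened {n : ℕ} {V M B : Matrix (Fin n) (Fin n) ℝ} (hV : V.PosDef)
    (hM : M.PosDef) (hB : V⁻¹ = Bᵀ * B) :
    Real.log (B * M * Bᵀ).det = Real.log M.det - Real.log V.det := by
  have h : (B * M * Bᵀ).det = V⁻¹.det * M.det := by
    rw [hB]; simp only [Matrix.det_mul]; ring
  rw [h, Real.log_mul hV.inv.det_pos.ne' hM.det_pos.ne', Matrix.det_nonsing_inv,
    Ring.inverse_eq_inv', Real.log_inv]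
  ring

theorem trace_whitened {n : ℕ} {V M B : Matrix (Fin n) (Fin n) ℝ} (hB : V⁻¹ = Bᵀ * B) :
    (B * M * Bᵀ).trace = (V⁻¹ * M).trace := by
  rw [hB, Matrix.trace_mul_comm, ← Matrix.mul_assoc]

/-- Twice the cross entropy of centred normal distributions is minimal at the true covariance. -/
theorem log_det_add_le {n : ℕ} {V M : Matrix (Fin n) (Fin n) ℝ} (hV : V.PosDef) (hM : M.PosDef) :
    Real.log M.det + n ≤ Real.log V.det + (V⁻¹ * M).trace := by
  obtain ⟨B, hB, hu⟩ := exists_whitening hV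
  have := log_det_le_trace_sub (posDef_mul_mul_transpose hM hu)
  rw [log_det_whitened hV hM hB, trace_whitened hB] at this
  linarith

theorem eq_of_log_det_add_eq {n : ℕ} {V M : Matrix (Fin n) (Fin n) ℝ} (hV : V.PosDef)
    (hM : M.PosDef) (h : Real.log V.det + (V⁻¹ * M).trace = Real.log M.det + n) : V = M := by
  obtain ⟨B, hB, hu⟩ := exists_whitening hV
  have h1 : B * M * Bᵀ = 1 := by
    refine eq_one_of_log_det_eq (posDef_mul_mul_transpose hM hu) ?_
    rw [log_det_whitened hV hM hB, trace_whitened hB]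
    linarith
  have h2 : M * Bᵀ * B = 1 := by
    rw [Matrix.mul_assoc] at h1
    exact mul_eq_one_comm.1 h1
  rw [Matrix.mul_assoc, ← hB] at h2
  have hVu : IsUnit V.det := hV.det_pos.ne'.isUnit
  calc V = M * V⁻¹ * V := by rw [h2, one_mul]
    _ = M := by rw [Matrix.mul_assoc, Matrix.nonsing_inv_mul _ hVu, mul_one]

theorem trace_mul_vecMulVec {n : ℕ} (W : Matrix (Fin n) (Fin n) ℝ) (u : Fin n → ℝ) :
    (W * Matrix.vecMulVec u u).trace = u ⬝ᵥ (W *ᵥ u) := by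
  rw [Matrix.mul_vecMulVec, Matrix.trace_vecMulVec, dotProduct_comm]

theorem trace_mul_nonneg {n : ℕ} {W D : Matrix (Fin n) (Fin n) ℝ} (hW : W.PosSemidef)
    (hD : D.PosSemidef) : 0 ≤ (W * D).trace := by
  obtain ⟨B, rfl⟩ := exists_eq_transpose_mul_self hW
  rw [Matrix.mul_assoc, Matrix.trace_mul_comm]
  have := hD.mul_mul_conjTranspose_same B
  rw [Matrix.conjTranspose_eq_transpose_of_trivial] at this
  exact this.trace_nonneg

theorem dotProduct_mulVec_nonneg {n : ℕ} {W : Matrix (Fin n) (Fin n) ℝ} (hW : W.PosSemidef)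
    (x : Fin n → ℝ) : 0 ≤ x ⬝ᵥ (W *ᵥ x) := by
  simpa using hW.dotProduct_mulVec_nonneg x

theorem posSemidef_vecMulVec_self {n : ℕ} (u : Fin n → ℝ) :
    (Matrix.vecMulVec u u).PosSemidef := by
  simpa using Matrix.posSemidef_vecMulVec_self_star u

/-! ### The inner product of `V⁻¹`, and rank-one updates. -/

theorem inv_mulVec_col {n : ℕ} {V : Matrix (Fin n) (Fin n) ℝ} (hV : V.PosDef) (j : Fin n) :
    V⁻¹ *ᵥ V.col j = Pi.single j 1 := by
  rw [← Matrix.mulVec_single_one, Matrix.mulVec_mulVec,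
    Matrix.nonsing_inv_mul _ hV.det_pos.ne'.isUnit, Matrix.one_mulVec]

/-- Pythagoras for the inner product of `V⁻¹`: since `V⁻¹` sends column `j` of `V` to `e_j`, pairing
with that column reads off `x j`, and the subtracted vector is the orthogonal projection onto it. -/
theorem dotProduct_inv_mulVec_sub_col {n : ℕ} {V : Matrix (Fin n) (Fin n) ℝ} (hV : V.PosDef)
    (x : Fin n → ℝ) (j : Fin n) :
    (x - (x j / V j j) • V.col j) ⬝ᵥ (V⁻¹ *ᵥ (x - (x j / V j j) • V.col j)) =
      x ⬝ᵥ (V⁻¹ *ᵥ x) - x j ^ 2 / V j j := by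
  have hd : V j j ≠ 0 := hV.diag_pos.ne'
  have hsymm : V.col j ⬝ᵥ (V⁻¹ *ᵥ x) = x j := by
    rw [Matrix.dotProduct_mulVec, ← Matrix.mulVec_transpose]
    have : (V⁻¹)ᵀ = V⁻¹ := by
      rw [← Matrix.conjTranspose_eq_transpose_of_trivial]; exact hV.inv.1
    rw [this, inv_mulVec_col hV]; simp
  rw [Matrix.mulVec_sub, Matrix.mulVec_smul, inv_mulVec_col hV]
  simp only [sub_dotProduct, dotProduct_sub, smul_dotProduct, dotProduct_smul, hsymm,
    dotProduct_single, smul_eq_mul, Pi.sub_apply, Pi.smul_apply, Matrix.col_apply]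
  field_simp
  ring

/-- Cauchy–Schwarz for the inner product given by `V⁻¹`. -/
theorem sq_div_le_dotProduct_inv_mulVec {n : ℕ} {V : Matrix (Fin n) (Fin n) ℝ} (hV : V.PosDef)
    (x : Fin n → ℝ) (j : Fin n) : x j ^ 2 / V j j ≤ x ⬝ᵥ (V⁻¹ *ᵥ x) := by
  have := dotProduct_mulVec_nonneg hV.inv.posSemidef (x - (x j / V j j) • V.col j)
  rw [dotProduct_inv_mulVec_sub_col hV] at this
  linarith

theorem eq_smul_col_of_dotProduct_inv_mulVec_eq {n : ℕ} {V : Matrix (Fin n) (Fin n) ℝ}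
    (hV : V.PosDef) (x : Fin n → ℝ) (j : Fin n) (h : x ⬝ᵥ (V⁻¹ *ᵥ x) = x j ^ 2 / V j j) :
    x = (x j / V j j) • V.col j := by
  by_contra hne
  have := hV.inv.dotProduct_mulVec_pos (sub_ne_zero.2 hne)
  rw [star_trivial, dotProduct_inv_mulVec_sub_col hV, h] at this
  linarith

theorem det_add_vecMulVec {n : ℕ} {V : Matrix (Fin n) (Fin n) ℝ} (hV : V.PosDef)
    (u : Fin n → ℝ) :
    (V + Matrix.vecMulVec u u).det = V.det * (1 + u ⬝ᵥ (V⁻¹ *ᵥ u)) := by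
  rw [Matrix.vecMulVec_eq Unit,
    Matrix.det_add_replicateCol_mul_replicateRow hV.det_pos.ne'.isUnit, Matrix.det_unique (n := Unit),
    Matrix.add_apply, Matrix.one_apply_eq, Matrix.mul_assoc]
  congr 1

theorem posDef_add_vecMulVec {n : ℕ} {V : Matrix (Fin n) (Fin n) ℝ} (hV : V.PosDef)
    (u : Fin n → ℝ) : (V + Matrix.vecMulVec u u).PosDef :=
  hV.add_posSemidef (posSemidef_vecMulVec_self u)

/-! ### Trace bounds for positive semidefinite matrices. -/

theorem abs_apply_le_trace {n : ℕ} {W : Matrix (Fin n) (Fin n) ℝ} (hW : W.PosSemidef)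
    (j k : Fin n) : |W j k| ≤ W.trace := by
  have hd : ∀ l, 0 ≤ W l l := fun l => hW.diag_nonneg
  have hle : ∀ l, W l l ≤ W.trace := fun l =>
    Finset.single_le_sum (f := fun l => W l l) (fun l _ => hd l) (Finset.mem_univ l)
  have hs : W k j = W j k := by simpa using hW.1.apply j k
  -- Testing on `e_j ± e_k` gives `2 |W j k| ≤ W j j + W k k`.
  have h1 := dotProduct_mulVec_nonneg hW (Pi.single j 1 + Pi.single k 1)
  have h2 := dotProduct_mulVec_nonneg hW (Pi.single j 1 - Pi.single k 1)
  simp only [Matrix.mulVec_add, Matrix.mulVec_sub, Matrix.mulVec_single_one, add_dotProduct,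
    sub_dotProduct, dotProduct_add, dotProduct_sub, single_dotProduct, one_mul,
    Matrix.col_apply, hs] at h1 h2
  have := hle j
  have := hle k
  rw [abs_le]
  constructor <;> linarith

theorem exists_smul_one_le {n : ℕ} {S : Matrix (Fin n) (Fin n) ℝ} (hS : S.PosDef) :
    ∃ l : ℝ, 0 < l ∧ (S - l • (1 : Matrix (Fin n) (Fin n) ℝ)).PosSemidef := by
  have ht : 0 ≤ S⁻¹.trace := hS.inv.posSemidef.trace_nonneg
  -- Cauchy–Schwarz summed over coordinates gives `|x|² ≤ tr S⁻¹ * xᵀ S x`; the added `1` keeps the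
  -- denominator positive even for `n = 0`.
  refine ⟨(1 + S⁻¹.trace)⁻¹, by positivity, ?_⟩
  refine Matrix.PosSemidef.of_dotProduct_mulVec_nonneg ?_ fun x => ?_
  · exact hS.1.sub (by simp [Matrix.IsHermitian])
  · have hq := dotProduct_mulVec_nonneg hS.posSemidef x
    have h1 : x ⬝ᵥ x ≤ S⁻¹.trace * (x ⬝ᵥ (S *ᵥ x)) := by
      rw [Matrix.trace, Finset.sum_mul]
      refine Finset.sum_le_sum fun j _ => ?_
      have := sq_div_le_dotProduct_inv_mulVec hS.inv x j
      rw [Matrix.nonsing_inv_nonsing_inv _ hS.det_pos.ne'.isUnit,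
        div_le_iff₀ hS.inv.diag_pos] at this
      simp only [Matrix.diag_apply]
      linarith
    simp only [star_trivial, Matrix.sub_mulVec, Matrix.smul_mulVec, Matrix.one_mulVec,
      dotProduct_sub, dotProduct_smul, smul_eq_mul, sub_nonneg]
    rw [inv_mul_le_iff₀ (by positivity)]
    linarith

theorem abs_trace_mul_le {n : ℕ} {W : Matrix (Fin n) (Fin n) ℝ} (hW : W.PosSemidef)
    (D : Matrix (Fin n) (Fin n) ℝ) :
    |(W * D).trace| ≤ W.trace * ∑ j, ∑ k, |D k j| := by
  rw [Matrix.trace, Finset.mul_sum]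
  refine (Finset.abs_sum_le_sum_abs _ _).trans (Finset.sum_le_sum fun j _ => ?_)
  rw [Matrix.diag_apply, Matrix.mul_apply, Finset.mul_sum]
  refine (Finset.abs_sum_le_sum_abs _ _).trans (Finset.sum_le_sum fun k _ => ?_)
  rw [abs_mul]
  exact mul_le_mul_of_nonneg_right (abs_apply_le_trace hW j k) (abs_nonneg _)

/-- At `C = S` a multiple of the identity below `S` gives the bound; moving `C` costs at most `tr W`
times the entrywise distance, so half the constant survives nearby. -/
theorem exists_eventually_le_trace_mul {n : ℕ} {S : Matrix (Fin n) (Fin n) ℝ} (hS : S.PosDef) :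
    ∃ l : ℝ, 0 < l ∧ ∀ᶠ C in 𝓝 S, ∀ W : Matrix (Fin n) (Fin n) ℝ, W.PosSemidef →
      l * W.trace ≤ (W * C).trace := by
  obtain ⟨l, hl, hps⟩ := exists_smul_one_le hS
  refine ⟨l / 2, by positivity, ?_⟩
  have hc : Continuous fun C : Matrix (Fin n) (Fin n) ℝ => ∑ j, ∑ k, |(C - S) k j| := by
    fun_prop
  have h0 : (∑ j, ∑ k, |(S - S) k j|) < l / 2 := by simp; positivity
  filter_upwards [hc.continuousAt.eventually_lt continuousAt_const h0] with C hC W hW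
  have h1 := trace_mul_nonneg hW hps
  have h2 := (abs_le.1 (abs_trace_mul_le hW (C - S))).1
  have h3 := mul_le_mul_of_nonneg_left hC.le hW.trace_nonneg
  rw [Matrix.mul_sub, Matrix.trace_sub] at h1 h2
  rw [Matrix.mul_smul, Matrix.mul_one, Matrix.trace_smul, smul_eq_mul] at h1
  linarith

/-- Rescaling by `l` before using `log x ≤ x - 1` lets an arbitrarily small multiple of the trace
dominate the log-determinant. -/
theorem log_det_le_mul_trace {n : ℕ} {W : Matrix (Fin n) (Fin n) ℝ} (hW : W.PosDef) {l : ℝ}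
    (hl : 0 < l) : Real.log W.det ≤ l * W.trace - n - n * Real.log l := by
  have := log_det_le_trace_sub (hW.smul hl)
  rw [Matrix.det_smul, Fintype.card_fin, Real.log_mul (by positivity) hW.det_pos.ne',
    Real.log_pow, Matrix.trace_smul, smul_eq_mul] at this
  linarith

/-! ### Cross entropy: continuity, coercivity and gaps. -/

/-- Twice the cross entropy between a distribution with mean `x.1` and covariance matrix `x.2`
and the normal distribution with parameters `p`, up to the constant `n * log (2 * π)`. -/
noncomputable def crossEntropy {n : ℕ}
    (x : EuclideanSpace ℝ (Fin n) × Matrix (Fin n) (Fin n) ℝ) (p : Param n) : ℝ :=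
  Real.log p.2.1.det +
    (p.2.1⁻¹ * (x.2 + Matrix.vecMulVec (x.1 - p.1).ofLp (x.1 - p.1).ofLp)).trace

theorem crossEntropy_eq {n : ℕ}
    (x : EuclideanSpace ℝ (Fin n) × Matrix (Fin n) (Fin n) ℝ) (p : Param n) :
    crossEntropy x p = Real.log p.2.1.det + (p.2.1⁻¹ * x.2).trace +
      (x.1 - p.1).ofLp ⬝ᵥ (p.2.1⁻¹ *ᵥ (x.1 - p.1).ofLp) := by
  rw [crossEntropy, Matrix.mul_add, Matrix.trace_add, trace_mul_vecMulVec, add_assoc]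

theorem continuous_coe_inv (n : ℕ) : Continuous fun V : CovMatrix n => V.1⁻¹ := by
  simp only [Matrix.inv_def, Ring.inverse_eq_inv']
  refine Continuous.smul (Continuous.inv₀ (Continuous.matrix_det continuous_subtype_val)
    fun V => V.2.det_pos.ne') ?_
  exact Continuous.matrix_adjugate continuous_subtype_val

theorem continuous_crossEntropy (n : ℕ) :
    Continuous fun z : (EuclideanSpace ℝ (Fin n) × Matrix (Fin n) (Fin n) ℝ) × Param n =>
      crossEntropy z.1 z.2 := by
  unfold crossEntropy
  refine Continuous.add (Continuous.log (by fun_prop) fun z => z.2.2.2.det_pos.ne') ?_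
  refine Continuous.matrix_trace (Continuous.matrix_mul ?_ ?_)
  · exact (continuous_coe_inv n).comp (continuous_snd.comp continuous_snd)
  · refine Continuous.add (by fun_prop) (Continuous.matrix_vecMulVec ?_ ?_) <;> fun_prop

theorem isClosed_setOf_posSemidef (n : ℕ) :
    IsClosed {W : Matrix (Fin n) (Fin n) ℝ | W.PosSemidef} := by
  have : {W : Matrix (Fin n) (Fin n) ℝ | W.PosSemidef} =
      {W | Wᵀ = W} ∩ ⋂ x : Fin n → ℝ, {W | 0 ≤ x ⬝ᵥ (W *ᵥ x)} := by
    ext W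
    simp [Matrix.posSemidef_iff_dotProduct_mulVec, Matrix.IsHermitian]
  rw [this]
  refine (isClosed_eq (by fun_prop) (by fun_prop)).inter (isClosed_iInter fun x => ?_)
  exact isClosed_le continuous_const
    (Continuous.dotProduct continuous_const (Continuous.matrix_mulVec continuous_id continuous_const))

/-- The trace bounds all entries, and the lower bound on the determinant keeps limits nonsingular,
so the set is closed among all matrices. -/
theorem isCompact_setOf_trace_le_det_ge (n : ℕ) (R : ℝ) {d : ℝ} (hd : 0 < d) :
    IsCompact {W : CovMatrix n | W.1.trace ≤ R ∧ d ≤ W.1.det} := by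
  rw [Subtype.isCompact_iff]
  have himg : ((↑) : CovMatrix n → Matrix (Fin n) (Fin n) ℝ) ''
      {W : CovMatrix n | W.1.trace ≤ R ∧ d ≤ W.1.det} =
      {W | W.PosSemidef} ∩ ({W | W.trace ≤ R} ∩ {W | d ≤ W.det}) := by
    ext W
    constructor
    · rintro ⟨W, h, rfl⟩
      exact ⟨W.2.posSemidef, h⟩
    · rintro ⟨h1, h2, h3⟩
      exact ⟨⟨W, h1.posDef_iff_det_ne_zero.2 (hd.trans_le h3).ne'⟩, ⟨h2, h3⟩, rfl⟩
  rw [himg]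
  have hbox : IsCompact (Set.univ.pi fun _ : Fin n => Set.univ.pi fun _ : Fin n =>
      Set.Icc (-R) R) := isCompact_univ_pi fun _ => isCompact_univ_pi fun _ => isCompact_Icc
  refine hbox.of_isClosed_subset ?_ ?_
  · refine (isClosed_setOf_posSemidef n).inter ((isClosed_le ?_ continuous_const).inter
      (isClosed_le continuous_const ?_))
    · exact Continuous.matrix_trace continuous_id
    · exact Continuous.matrix_det continuous_id
  · rintro W ⟨h1, h2, -⟩ j - k -
    exact abs_le.1 ((abs_apply_le_trace h1 j k).trans h2)

/-- In terms of the precision `W = V⁻¹`, the cross entropy is at least `l * tr W - log det W` plus a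
nonnegative quadratic term. A bound on it bounds `tr W` above and `det W` below, which confines `V`
to a compact set; the quadratic term then confines the mean. -/
theorem exists_isCompact_forall_notMem_lt_crossEntropy {n : ℕ} (A : EuclideanSpace ℝ (Fin n))
    {S : Matrix (Fin n) (Fin n) ℝ} (hS : S.PosDef) (c : ℝ) :
    ∃ K : Set (Param n), IsCompact K ∧ ∀ᶠ x in 𝓝 (A, S), ∀ p ∉ K, c < crossEntropy x p := by
  obtain ⟨l, hl, hC⟩ := exists_eventually_le_trace_mul hS
  -- `b` is the constant in `log det W ≤ (l / 2) * tr W - b`; `Q` bounds the quadratic term on the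
  -- sublevel set.
  set b : ℝ := n + n * Real.log (l / 2) with hb
  set Q : ℝ := c + (c - b) - b with hQ
  set Kinv : Set (CovMatrix n) := {W | W.1.trace ≤ 2 / l * (c - b) ∧ Real.exp (-c) ≤ W.1.det}
  have hKinv : IsCompact Kinv := isCompact_setOf_trace_le_det_ge n _ (Real.exp_pos _)
  set inv : CovMatrix n → CovMatrix n := fun V => ⟨V.1⁻¹, V.2.inv⟩
  have hinv : Continuous inv := (continuous_coe_inv n).subtype_mk _
  have hinvinv : ∀ V, inv (inv V) = V := fun V =>
    Subtype.ext (Matrix.nonsing_inv_nonsing_inv _ V.2.det_pos.ne'.isUnit)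
  have hKc := hKinv.image hinv
  obtain ⟨T, hT⟩ := (hKc.image (f := fun V : CovMatrix n => V.1.trace)
    (Continuous.matrix_trace continuous_subtype_val)).bddAbove
  -- The radius allows `1` for the distance from `x.1` to `A` and `√(T * Q)` for that from `a` to
  -- `x.1`, where `T` bounds `tr V`.
  refine ⟨Metric.closedBall A (1 + √(T * Q)) ×ˢ (inv '' Kinv),
    (isCompact_closedBall _ _).prod hKc, ?_⟩
  have hball : ∀ᶠ x in 𝓝 (A, S), x.1 ∈ Metric.ball A 1 :=
    continuousAt_fst.eventually (Metric.ball_mem_nhds A one_pos)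
  have hC' : ∀ᶠ x in 𝓝 (A, S), ∀ W : Matrix (Fin n) (Fin n) ℝ, W.PosSemidef →
      l * W.trace ≤ (W * x.2).trace := (continuousAt_snd (p := (A, S))).eventually hC
  filter_upwards [hball, hC'] with x hx hxC p hp
  by_contra! hle
  apply hp
  obtain ⟨a, V⟩ := p
  rw [crossEntropy_eq] at hle
  dsimp only at hle
  have hWp := V.2.inv
  have hdet : Real.log V.1.det = - Real.log V.1⁻¹.det := by
    rw [Matrix.det_nonsing_inv, Ring.inverse_eq_inv', Real.log_inv, neg_neg]
  have h1 := hxC _ hWp.posSemidef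
  have h2 := dotProduct_mulVec_nonneg hWp.posSemidef (x.1 - a).ofLp
  have h3 := log_det_le_mul_trace hWp (half_pos hl)
  have h4 : 0 ≤ l * V.1⁻¹.trace := mul_nonneg hl.le hWp.posSemidef.trace_nonneg
  rw [hdet] at hle
  have hVmem : V ∈ inv '' Kinv := by
    refine ⟨inv V, ⟨?_, ?_⟩, hinvinv V⟩
    · change V.1⁻¹.trace ≤ _
      rw [div_mul_eq_mul_div, le_div_iff₀ hl]
      linarith
    · change _ ≤ V.1⁻¹.det
      rw [← Real.le_log_iff_exp_le hWp.det_pos]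
      linarith
  refine ⟨?_, hVmem⟩
  have hq : (x.1 - a).ofLp ⬝ᵥ (V.1⁻¹ *ᵥ (x.1 - a).ofLp) ≤ Q := by linarith
  have hVT : V.1.trace ≤ T := hT ⟨V, hVmem, rfl⟩
  have hnorm : ‖x.1 - a‖ ^ 2 ≤ T * Q := by
    rw [EuclideanSpace.real_norm_sq_eq]
    calc ∑ j, (x.1 - a).ofLp j ^ 2 ≤ ∑ j, V.1 j j * Q := by
          refine Finset.sum_le_sum fun j _ => ?_
          have := sq_div_le_dotProduct_inv_mulVec V.2 (x.1 - a).ofLp j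
          rw [div_le_iff₀ V.2.diag_pos] at this
          nlinarith [V.2.diag_pos (i := j)]
      _ = V.1.trace * Q := by rw [← Finset.sum_mul]; rfl
      _ ≤ T * Q := mul_le_mul_of_nonneg_right hVT (h2.trans hq)
  have h5 : dist a x.1 ≤ √(T * Q) := by
    rw [dist_comm, dist_eq_norm]
    exact Real.le_sqrt_of_sq_le hnorm
  have h6 : dist x.1 A < 1 := hx
  rw [Metric.mem_closedBall]
  linarith [dist_triangle a x.1 A]

/-- Coercivity handles parameters outside a compact set, uniformly in the moments; on the compact
part joint continuity suffices. -/
theorem eventually_forall_lt_crossEntropy {n : ℕ} (A : EuclideanSpace ℝ (Fin n))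
    {S : Matrix (Fin n) (Fin n) ℝ} (hS : S.PosDef) {F : Set (Param n)} (hF : IsClosed F) {c : ℝ}
    (hc : ∀ p ∈ F, c < crossEntropy (A, S) p) :
    ∀ᶠ x in 𝓝 (A, S), ∀ p ∈ F, c < crossEntropy x p := by
  obtain ⟨K, hK, hKev⟩ := exists_isCompact_forall_notMem_lt_crossEntropy A hS c
  have h := (hK.inter_right hF).eventually_forall_of_forall_eventually (x₀ := (A, S))
    (P := fun x p => c < crossEntropy x p) fun p hp =>
      continuousAt_const.eventually_lt (continuous_crossEntropy n).continuousAt (hc p hp.2)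
  filter_upwards [hKev, h] with x h1 h2 p hp
  by_cases hpK : p ∈ K
  · exact h2 p ⟨hpK, hp⟩
  · exact h1 p hpK

/-- On the compact part of `F` the minimum is attained, hence exceeds `c`; elsewhere the value
exceeds `c + 1`. -/
theorem exists_gap_crossEntropy {n : ℕ} (A : EuclideanSpace ℝ (Fin n))
    {S : Matrix (Fin n) (Fin n) ℝ} (hS : S.PosDef) {F : Set (Param n)} (hF : IsClosed F) {c : ℝ}
    (hc : ∀ p ∈ F, c < crossEntropy (A, S) p) :
    ∃ c' > c, ∀ p ∈ F, c' < crossEntropy (A, S) p := by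
  obtain ⟨K, hK, hKev⟩ := exists_isCompact_forall_notMem_lt_crossEntropy A hS (c + 1)
  have hK' := hKev.self_of_nhds
  have hcont : Continuous fun p => crossEntropy (A, S) p :=
    (continuous_crossEntropy n).comp (Continuous.prodMk_right (A, S))
  rcases (K ∩ F).eq_empty_or_nonempty with he | hne
  · refine ⟨c + 1, by linarith, fun p hp => hK' p fun hpK => ?_⟩
    exact (he ▸ (⟨hpK, hp⟩ : p ∈ K ∩ F) : p ∈ (∅ : Set (Param n)))
  · obtain ⟨p₀, hp₀, hmin⟩ := (hK.inter_right hF).exists_isMinOn hne hcont.continuousOn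
    have h0 := hc p₀ hp₀.2
    obtain ⟨c', hc1, hc2⟩ := exists_between (lt_min h0 (lt_add_one c))
    refine ⟨c', hc1, fun p hp => ?_⟩
    by_cases hpK : p ∈ K
    · exact (hc2.trans_le (min_le_left _ _)).trans_le (hmin ⟨hpK, hp⟩)
    · exact (hc2.trans_le (min_le_right _ _)).trans (hK' p hpK)

/-! ### The likelihood as a function of the empirical moments. -/

/-- Mean and (biased) covariance matrix of the first `t` terms of `q`. -/
noncomputable def empiricalMoments {n : ℕ} (q : ℕ → EuclideanSpace ℝ (Fin n)) (t : ℕ) :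
    EuclideanSpace ℝ (Fin n) × Matrix (Fin n) (Fin n) ℝ :=
  (WithLp.toLp 2 fun j => (∑ z ∈ Finset.range t, q z j) / t,
    Matrix.of fun j k => (∑ z ∈ Finset.range t, q z j * q z k) / t -
      ((∑ z ∈ Finset.range t, q z j) / t) * ((∑ z ∈ Finset.range t, q z k) / t))

/-- Bias–variance decomposition of the scatter around `a`. -/
theorem sum_vecMulVec_sub {n : ℕ} (q : ℕ → EuclideanSpace ℝ (Fin n)) {t : ℕ} (ht : t ≠ 0)
    (a : EuclideanSpace ℝ (Fin n)) :
    ∑ z ∈ Finset.range t, Matrix.vecMulVec (q z - a).ofLp (q z - a).ofLp =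
      (t : ℝ) • ((empiricalMoments q t).2 + Matrix.vecMulVec ((empiricalMoments q t).1 - a).ofLp
        ((empiricalMoments q t).1 - a).ofLp) := by
  ext j k
  have ht' : (t : ℝ) ≠ 0 := Nat.cast_ne_zero.2 ht
  simp only [empiricalMoments, Matrix.sum_apply, Matrix.vecMulVec_apply, Matrix.smul_apply,
    Matrix.add_apply, Matrix.of_apply, PiLp.sub_apply, smul_eq_mul, sub_mul, mul_sub,
    Finset.sum_sub_distrib, ← Finset.sum_mul, ← Finset.mul_sum, Finset.sum_const,
    Finset.card_range, nsmul_eq_mul]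
  field_simp
  ring

theorem density_eq_exp {n : ℕ} (q : EuclideanSpace ℝ (Fin n)) (p : Param n) :
    density q p = Real.exp (-(1 / 2) * (n * Real.log (2 * Real.pi) + Real.log p.2.1.det +
      (p.2.1⁻¹ * Matrix.vecMulVec (q - p.1).ofLp (q - p.1).ofLp).trace)) := by
  have hd := p.2.2.det_pos
  have hpos : 0 < (2 * Real.pi) ^ n * p.2.1.det := by positivity
  rw [density, trace_mul_vecMulVec, mul_add, Real.exp_add, one_div, ← Real.log_pow,
    ← Real.log_mul (by positivity) hd.ne', Real.sqrt_eq_rpow, ← Real.rpow_neg hpos.le,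
    Real.rpow_def_of_pos hpos, mul_comm (Real.log _)]

theorem likelihood_eq_exp {n : ℕ} (q : ℕ → EuclideanSpace ℝ (Fin n)) {t : ℕ} (ht : t ≠ 0)
    (p : Param n) :
    likelihood t q p = Real.exp (-(t / 2) * (n * Real.log (2 * Real.pi) +
      crossEntropy (empiricalMoments q t) p)) := by
  have ht' : (t : ℝ) ≠ 0 := Nat.cast_ne_zero.2 ht
  rw [likelihood, Finset.prod_congr rfl fun z _ => density_eq_exp (q z) p, ← Real.exp_sum,
    ← Finset.mul_sum, Finset.sum_add_distrib, ← Matrix.trace_sum, ← Finset.mul_sum,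
    sum_vecMulVec_sub q ht, Matrix.mul_smul, Matrix.trace_smul, crossEntropy]
  simp only [Finset.sum_const, Finset.card_range, nsmul_eq_mul, smul_eq_mul]
  congr 1
  ring

/-! ### Almost sure convergence of the empirical moments. -/

theorem tendsto_average_of_iIndepFun {E Ω : Type*} [MeasurableSpace E] [MeasurableSpace Ω]
    {μ : Measure Ω} {ν : Measure E} {ε : ℕ → Ω → E}
    (hlaw : ∀ t, HasLaw (ε t) ν μ) (hindep : iIndepFun ε μ) {f : E → ℝ} (hf : Measurable f)
    (hint : Integrable f ν) :
    ∀ᵐ ω ∂μ, Tendsto (fun t : ℕ => (∑ z ∈ Finset.range t, f (ε z ω)) / t) atTop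
      (𝓝 (∫ x, f x ∂ν)) := by
  have hid : ∀ t, IdentDistrib (ε t) (ε 0) μ μ := fun t =>
    ⟨(hlaw t).aemeasurable, (hlaw 0).aemeasurable, by rw [(hlaw t).map_eq, (hlaw 0).map_eq]⟩
  have h := strong_law_ae_real (μ := μ) (fun t ω => f (ε t ω)) ?_ ?_ ?_
  · have hE : ∫ ω, f (ε 0 ω) ∂μ = ∫ x, f x ∂ν := by
      rw [← (hlaw 0).map_eq, integral_map (hlaw 0).aemeasurable hf.aestronglyMeasurable]
    rwa [hE] at h
  · rw [← (hlaw 0).map_eq] at hint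
    exact hint.comp_aemeasurable (hlaw 0).aemeasurable
  · intro s t hst
    exact (hindep.indepFun hst).comp hf hf
  · intro t
    exact (hid t).comp hf

theorem memLp_two_eval_multivariateGaussian {n : ℕ} (S : Matrix (Fin n) (Fin n) ℝ) (j : Fin n) :
    MemLp (fun x : EuclideanSpace ℝ (Fin n) => x j) 2 (multivariateGaussian 0 S) :=
  (IsGaussian.memLp_two_id (μ := multivariateGaussian 0 S)).continuousLinearMap_comp
    (EuclideanSpace.proj j : EuclideanSpace ℝ (Fin n) →L[ℝ] ℝ)

theorem integral_eval_multivariateGaussian {n : ℕ} (S : Matrix (Fin n) (Fin n) ℝ) (j : Fin n) :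
    ∫ x, x j ∂(multivariateGaussian 0 S) = 0 := by
  have := ContinuousLinearMap.integral_comp_comm
    (EuclideanSpace.proj j : EuclideanSpace ℝ (Fin n) →L[ℝ] ℝ)
    (IsGaussian.integrable_id (μ := multivariateGaussian 0 S))
  simpa using this

theorem integral_mul_eval_multivariateGaussian {n : ℕ} {S : Matrix (Fin n) (Fin n) ℝ}
    (hS : S.PosSemidef) (j k : Fin n) :
    ∫ x, x j * x k ∂(multivariateGaussian 0 S) = S j k := by
  have := covariance_eval_multivariateGaussian (μ := 0) hS j k
  simpa [covariance, integral_eval_multivariateGaussian] using this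

theorem tendsto_empiricalMoments {n : ℕ} {Ω : Type*} [MeasurableSpace Ω] {μ : Measure Ω}
    (A : EuclideanSpace ℝ (Fin n)) {S : Matrix (Fin n) (Fin n) ℝ} (hS : S.PosSemidef)
    {ε : ℕ → Ω → EuclideanSpace ℝ (Fin n)}
    (hlaw : ∀ t, HasLaw (ε t) (multivariateGaussian 0 S) μ) (hindep : iIndepFun ε μ) :
    ∀ᵐ ω ∂μ, Tendsto (empiricalMoments fun t => recognition A (ε t ω)) atTop (𝓝 (A, S)) := by
  have hi : ∀ j, Integrable (fun x : EuclideanSpace ℝ (Fin n) => x j)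
      (multivariateGaussian 0 S) := fun j =>
    (memLp_two_eval_multivariateGaussian S j).integrable one_le_two
  have hii : ∀ j k, Integrable (fun x : EuclideanSpace ℝ (Fin n) => x j * x k)
      (multivariateGaussian 0 S) := fun j k =>
    (memLp_two_eval_multivariateGaussian S j).integrable_mul
      (memLp_two_eval_multivariateGaussian S k)
  have h1 : ∀ j, ∀ᵐ ω ∂μ, Tendsto (fun t : ℕ =>
      (∑ z ∈ Finset.range t, (A j + ε z ω j)) / t) atTop (𝓝 (A j)) := fun j => by
    have h := tendsto_average_of_iIndepFun hlaw hindep (f := fun x => A j + x j) (by fun_prop)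
      ((integrable_const _).add (hi j))
    rwa [integral_add (integrable_const _) (hi j), integral_eval_multivariateGaussian,
      integral_const, probReal_univ, one_smul, add_zero] at h
  have h2 : ∀ j k, ∀ᵐ ω ∂μ, Tendsto (fun t : ℕ =>
      (∑ z ∈ Finset.range t, (A j + ε z ω j) * (A k + ε z ω k)) / t) atTop
      (𝓝 (S j k + A j * A k)) := fun j k => by
    have hsplit : (fun x : EuclideanSpace ℝ (Fin n) => (A j + x j) * (A k + x k)) =
        fun x => A j * A k + A j * x k + A k * x j + x j * x k := by
      funext x; ring
    have hI1 : Integrable (fun x : EuclideanSpace ℝ (Fin n) => A j * A k + A j * x k)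
      (multivariateGaussian 0 S) := (integrable_const _).add ((hi k).const_mul _)
    have hI2 : Integrable (fun x : EuclideanSpace ℝ (Fin n) => A j * A k + A j * x k + A k * x j)
      (multivariateGaussian 0 S) := hI1.add ((hi j).const_mul _)
    have h := tendsto_average_of_iIndepFun hlaw hindep
      (f := fun x => (A j + x j) * (A k + x k)) (by fun_prop)
      (by rw [hsplit]; exact hI2.add (hii j k))
    rwa [hsplit, integral_add hI2 (hii j k), integral_add hI1 ((hi j).const_mul _),
      integral_add (integrable_const _) ((hi k).const_mul _), integral_const,
      integral_const_mul, integral_const_mul, integral_eval_multivariateGaussian,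
      integral_eval_multivariateGaussian, integral_mul_eval_multivariateGaussian hS,
      probReal_univ, one_smul,
      mul_zero, mul_zero, add_zero, add_zero, add_comm (A j * A k)] at h
  filter_upwards [ae_all_iff.2 h1, ae_all_iff.2 fun j => ae_all_iff.2 (h2 j)] with ω h1 h2
  refine Tendsto.prodMk_nhds ?_ ?_
  · have : Tendsto (fun t : ℕ => fun j => (∑ z ∈ Finset.range t, (A j + ε z ω j)) / (t : ℝ)) atTop
        (𝓝 A.ofLp) := tendsto_pi_nhds.2 h1
    exact ((PiLp.continuous_toLp 2 fun _ : Fin n => ℝ).tendsto A.ofLp).comp this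
  · refine tendsto_pi_nhds.2 fun j => tendsto_pi_nhds.2 fun k => ?_
    have := (h2 j k).sub ((h1 j).mul (h1 k))
    rwa [add_sub_cancel_right] at this

/-! ### The constrained minimiser of the cross entropy. -/

instance instSecondCountableTopologyMatrix (n : ℕ) :
    SecondCountableTopology (Matrix (Fin n) (Fin n) ℝ) :=
  inferInstanceAs (SecondCountableTopology (Fin n → Fin n → ℝ))

/-- Second countability gives the prior's support full measure: its complement is a union of null
open sets, of which countably many suffice. -/
instance instSecondCountableTopologyCovMatrix (n : ℕ) : SecondCountableTopology (CovMatrix n) :=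
  TopologicalSpace.Subtype.secondCountableTopology
    {S : Matrix (Fin n) (Fin n) ℝ | S.PosDef}

/-- The minimum of `crossEntropy (A, S)` over the parameters that assign caliber `ai` to `i`. -/
noncomputable def minCrossEntropy {n : ℕ} (A : EuclideanSpace ℝ (Fin n))
    (S : Matrix (Fin n) (Fin n) ℝ) (i : Fin n) (ai : ℝ) : ℝ :=
  Real.log S.det + Real.log (1 + (A i - ai) ^ 2 / S i i) + n

/-- The error in the calibers that is attributed to a caliber `ai` of individual `i`. -/
noncomputable def limitBias {n : ℕ} (A : EuclideanSpace ℝ (Fin n))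
    (S : Matrix (Fin n) (Fin n) ℝ) (i : Fin n) (ai : ℝ) (j : Fin n) : ℝ :=
  S i j / S i i * (ai - A i)

/-- The parameters with caliber `ai` of individual `i` that minimise `crossEntropy (A, S)`. -/
noncomputable def limitParam {n : ℕ} (A : EuclideanSpace ℝ (Fin n))
    {S : Matrix (Fin n) (Fin n) ℝ} (hS : S.PosDef) (i : Fin n) (ai : ℝ) : Param n :=
  (A + WithLp.toLp 2 (limitBias A S i ai),
    ⟨S + Matrix.vecMulVec (limitBias A S i ai) (limitBias A S i ai), posDef_add_vecMulVec hS _⟩)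

theorem limitBias_eq_smul_col {n : ℕ} (A : EuclideanSpace ℝ (Fin n))
    {S : Matrix (Fin n) (Fin n) ℝ} (hS : S.PosDef) (i : Fin n) (ai : ℝ) :
    limitBias A S i ai = ((ai - A i) / S i i) • S.col i := by
  funext j
  have hs : S i j = S j i := by simpa using hS.1.apply j i
  simp only [limitBias, Pi.smul_apply, Matrix.col_apply, smul_eq_mul, hs]
  ring

theorem limitBias_self {n : ℕ} (A : EuclideanSpace ℝ (Fin n))
    {S : Matrix (Fin n) (Fin n) ℝ} (hS : S.PosDef) (i : Fin n) (ai : ℝ) :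
    limitBias A S i ai i = ai - A i := by
  rw [limitBias, div_self hS.diag_pos.ne', one_mul]

theorem limitParam_fst_apply_self {n : ℕ} (A : EuclideanSpace ℝ (Fin n))
    {S : Matrix (Fin n) (Fin n) ℝ} (hS : S.PosDef) (i : Fin n) (ai : ℝ) :
    (limitParam A hS i ai).1 i = ai := by
  simp [limitParam, limitBias_self A hS]

theorem limitBias_dotProduct_inv_mulVec {n : ℕ} (A : EuclideanSpace ℝ (Fin n))
    {S : Matrix (Fin n) (Fin n) ℝ} (hS : S.PosDef) (i : Fin n) (ai : ℝ) :
    limitBias A S i ai ⬝ᵥ (S⁻¹ *ᵥ limitBias A S i ai) = (A i - ai) ^ 2 / S i i := by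
  have h := dotProduct_inv_mulVec_sub_col hS (limitBias A S i ai) i
  rw [limitBias_self A hS, ← limitBias_eq_smul_col A hS, sub_self, zero_dotProduct] at h
  rw [← sub_eq_zero, h, ← neg_sub (A i) ai, neg_sq]

theorem log_det_add_vecMulVec {n : ℕ} {S : Matrix (Fin n) (Fin n) ℝ} (hS : S.PosDef)
    (u : Fin n → ℝ) : Real.log (S + Matrix.vecMulVec u u).det =
      Real.log S.det + Real.log (1 + u ⬝ᵥ (S⁻¹ *ᵥ u)) := by
  have := dotProduct_mulVec_nonneg hS.inv.posSemidef u
  rw [det_add_vecMulVec hS, Real.log_mul hS.det_pos.ne' (by positivity)]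

theorem crossEntropy_limitParam {n : ℕ} (A : EuclideanSpace ℝ (Fin n))
    {S : Matrix (Fin n) (Fin n) ℝ} (hS : S.PosDef) (i : Fin n) (ai : ℝ) :
    crossEntropy (A, S) (limitParam A hS i ai) = minCrossEntropy A S i ai := by
  have hV := (posDef_add_vecMulVec hS (limitBias A S i ai)).det_pos.ne'.isUnit
  have hu : (A - (A + WithLp.toLp 2 (limitBias A S i ai))).ofLp = -limitBias A S i ai := by
    ext j; simp
  simp only [crossEntropy, limitParam, hu]
  rw [Matrix.neg_vecMulVec, Matrix.vecMulVec_neg, neg_neg, Matrix.nonsing_inv_mul _ hV,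
    log_det_add_vecMulVec hS, limitBias_dotProduct_inv_mulVec A hS, Matrix.trace_one,
    Fintype.card_fin, minCrossEntropy]

theorem minCrossEntropy_lt_crossEntropy {n : ℕ} (A : EuclideanSpace ℝ (Fin n))
    {S : Matrix (Fin n) (Fin n) ℝ} (hS : S.PosDef) {i : Fin n} {ai : ℝ} {p : Param n}
    (hp : p.1 i = ai) (hne : p ≠ limitParam A hS i ai) :
    minCrossEntropy A S i ai < crossEntropy (A, S) p := by
  obtain ⟨a, V⟩ := p
  set w := (A - a).ofLp with hw
  have hwi : w i = A i - ai := by rw [← hp]; rfl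
  have hM := posDef_add_vecMulVec hS w
  have h1 := log_det_add_le V.2 hM
  have h2 := sq_div_le_dotProduct_inv_mulVec hS w i
  have h3 : 0 < 1 + w i ^ 2 / S i i := by
    have := hS.diag_pos (i := i)
    positivity
  have h4 := Real.log_le_log h3 (add_le_add_right h2 1)
  rw [log_det_add_vecMulVec hS] at h1
  rw [hwi] at h4
  have hle : minCrossEntropy A S i ai ≤ crossEntropy (A, S) (a, V) := by
    simp only [minCrossEntropy, crossEntropy, ← hw]
    linarith
  -- Equality must hold in both stages: in the choice of `V` (`h5`) and in Cauchy–Schwarz (`h6`).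
  refine lt_of_le_of_ne hle fun heq => hne ?_
  simp only [minCrossEntropy, crossEntropy, ← hw] at heq
  have h5 : V.1 = S + Matrix.vecMulVec w w :=
    eq_of_log_det_add_eq V.2 hM (by rw [log_det_add_vecMulVec hS]; linarith)
  have h6 : w ⬝ᵥ (S⁻¹ *ᵥ w) = w i ^ 2 / S i i := by
    have h7 : Real.log (1 + w i ^ 2 / S i i) = Real.log (1 + w ⬝ᵥ (S⁻¹ *ᵥ w)) := by
      rw [hwi]; linarith
    have := Real.log_injOn_pos h3 (h3.trans_le (add_le_add_right h2 1)) h7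
    linarith
  have h8 : w = -limitBias A S i ai := by
    rw [eq_smul_col_of_dotProduct_inv_mulVec_eq hS w i h6, limitBias_eq_smul_col A hS, hwi,
      ← neg_smul, ← neg_div, neg_sub]
  refine Prod.ext ?_ (Subtype.ext ?_)
  · ext j
    have := congrFun h8 j
    simp only [hw, PiLp.sub_apply, Pi.neg_apply] at this
    simp only [limitParam, PiLp.add_apply]
    linarith
  · rw [h5, h8, Matrix.neg_vecMulVec, Matrix.vecMulVec_neg, neg_neg]
    rfl

/-! ### Concentration of the posterior. -/

theorem lintegral_likelihood_le {n : ℕ} {P₀ : Measure (Param n)} [IsProbabilityMeasure P₀]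
    {i : Fin n} {ai : ℝ} (hP₀ : IsStubbornPrior P₀ i ai) (q : ℕ → EuclideanSpace ℝ (Fin n))
    {t : ℕ} (ht : t ≠ 0) {F : Set (Param n)} (hF : MeasurableSet F) {c : ℝ}
    (hc : ∀ p ∈ {p : Param n | p.1 i = ai} ∩ F, c < crossEntropy (empiricalMoments q t) p) :
    ∫⁻ p in F, ENNReal.ofReal (likelihood t q p) ∂P₀ ≤
      ENNReal.ofReal (Real.exp (-(t / 2) * (n * Real.log (2 * Real.pi) + c))) := by
  have hsupp : ∀ᵐ p ∂P₀, p ∈ {p : Param n | p.1 i = ai} := by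
    have h : P₀.support ∈ ae P₀ := Measure.support_mem_ae
    rwa [show P₀.support = _ from hP₀] at h
  calc ∫⁻ p in F, ENNReal.ofReal (likelihood t q p) ∂P₀
      ≤ ∫⁻ _ in F, ENNReal.ofReal
          (Real.exp (-(t / 2) * (n * Real.log (2 * Real.pi) + c))) ∂P₀ := by
        refine lintegral_mono_ae ?_
        filter_upwards [ae_restrict_of_ae hsupp, ae_restrict_mem hF] with p hp hpF
        rw [likelihood_eq_exp q ht]
        refine ENNReal.ofReal_le_ofReal (Real.exp_le_exp.2 ?_)
        have := (hc p ⟨hp, hpF⟩).le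
        exact mul_le_mul_of_nonpos_left (by linarith) (neg_nonpos.2 (by positivity))
    _ ≤ _ := by
        rw [setLIntegral_const]
        exact mul_le_of_le_one_right' prob_le_one

theorem le_lintegral_likelihood {n : ℕ} (P₀ : Measure (Param n))
    (q : ℕ → EuclideanSpace ℝ (Fin n)) {t : ℕ} (ht : t ≠ 0) {U : Set (Param n)}
    (hU : MeasurableSet U) {c : ℝ}
    (hc : ∀ p ∈ U, crossEntropy (empiricalMoments q t) p < c) :
    ENNReal.ofReal (Real.exp (-(t / 2) * (n * Real.log (2 * Real.pi) + c))) * P₀ U ≤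
      ∫⁻ p, ENNReal.ofReal (likelihood t q p) ∂P₀ := by
  rw [← setLIntegral_const]
  refine (setLIntegral_mono' hU fun p hp => ?_).trans (setLIntegral_le_lintegral U _)
  rw [likelihood_eq_exp q ht]
  refine ENNReal.ofReal_le_ofReal (Real.exp_le_exp.2 ?_)
  have := (hc p hp).le
  exact mul_le_mul_of_nonpos_left (by linarith) (neg_nonpos.2 (by positivity))

theorem isClosed_setOf_fst_apply_eq {n : ℕ} (i : Fin n) (ai : ℝ) :
    IsClosed {p : Param n | p.1 i = ai} :=
  isClosed_eq (by fun_prop) continuous_const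

theorem measure_pos_of_limitParam_mem {n : ℕ} {P₀ : Measure (Param n)} {i : Fin n} {ai : ℝ}
    (hP₀ : IsStubbornPrior P₀ i ai) (A : EuclideanSpace ℝ (Fin n))
    {S : Matrix (Fin n) (Fin n) ℝ} (hS : S.PosDef) {U : Set (Param n)} (hU : IsOpen U)
    (hmem : limitParam A hS i ai ∈ U) : 0 < P₀ U := by
  refine (Measure.mem_support_iff_forall (limitParam A hS i ai)).1 ?_ U (hU.mem_nhds hmem)
  rw [show P₀.support = _ from hP₀]
  exact limitParam_fst_apply_self A hS i ai

theorem exists_isOpen_forall_crossEntropy_lt {n : ℕ} {x : EuclideanSpace ℝ (Fin n) ×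
    Matrix (Fin n) (Fin n) ℝ} {p : Param n} {c : ℝ} (h : crossEntropy x p < c) :
    ∃ U : Set (Param n), IsOpen U ∧ p ∈ U ∧ ∀ᶠ y in 𝓝 x, ∀ p' ∈ U, crossEntropy y p' < c := by
  have hev : ∀ᶠ z in 𝓝 (x, p), crossEntropy z.1 z.2 < c :=
    (continuous_crossEntropy n).continuousAt.eventually_lt continuousAt_const h
  rw [nhds_prod_eq, eventually_prod_iff] at hev
  obtain ⟨Q, hQ, R, hR, hQR⟩ := hev
  obtain ⟨U, hUR, hU, hpU⟩ := eventually_nhds_iff.1 hR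
  exact ⟨{p | p ∈ U}, hU, hpU, hQ.mono fun y hy p' hp' => hQR hy (hUR p' hp')⟩

/-- This rules out the degenerate values of division in `ℝ≥0∞`, so that posteriors of complementary
sets add up to `1`. -/
theorem eventually_lintegral_likelihood {n : ℕ} {P₀ : Measure (Param n)}
    [IsProbabilityMeasure P₀] {i : Fin n} {ai : ℝ} (hP₀ : IsStubbornPrior P₀ i ai)
    (A : EuclideanSpace ℝ (Fin n)) {S : Matrix (Fin n) (Fin n) ℝ} (hS : S.PosDef)
    {q : ℕ → EuclideanSpace ℝ (Fin n)} (hq : Tendsto (empiricalMoments q) atTop (𝓝 (A, S))) :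
    ∀ᶠ t in atTop, ∫⁻ p, ENNReal.ofReal (likelihood t q p) ∂P₀ ≠ 0 ∧
      ∫⁻ p, ENNReal.ofReal (likelihood t q p) ∂P₀ ≠ ∞ := by
  obtain ⟨U, hU, hpU, hUlt⟩ := exists_isOpen_forall_crossEntropy_lt
    (lt_add_one (crossEntropy (A, S) (limitParam A hS i ai)))
  have hlow : ∀ p ∈ {p : Param n | p.1 i = ai},
      minCrossEntropy A S i ai - 1 < crossEntropy (A, S) p := fun p hp => by
    by_cases hne : p = limitParam A hS i ai
    · rw [hne, crossEntropy_limitParam]; exact sub_one_lt _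
    · exact (sub_one_lt _).trans (minCrossEntropy_lt_crossEntropy A hS hp hne)
  filter_upwards [eventually_ne_atTop 0, hq.eventually hUlt,
    hq.eventually (eventually_forall_lt_crossEntropy A hS (isClosed_setOf_fst_apply_eq i ai) hlow)]
    with t ht h1 h2
  constructor
  · refine ((ENNReal.mul_pos ?_ ?_).trans_le
      (le_lintegral_likelihood P₀ q ht hU.measurableSet h1)).ne'
    · exact (ENNReal.ofReal_pos.2 (Real.exp_pos _)).ne'
    · exact (measure_pos_of_limitParam_mem hP₀ A hS hU hpU).ne'
  · rw [← setLIntegral_univ]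
    exact ((lintegral_likelihood_le hP₀ q ht MeasurableSet.univ
      fun p hp => h2 p hp.1).trans_lt ENNReal.ofReal_lt_top).ne

/-- Laplace's method: off `B` the cross entropy exceeds `c'` on the prior's support, while on a
neighbourhood `U` of the minimiser, of positive prior mass, it is below some `c < c'`. The ratio
decays like `exp (-t (c' - c) / 2)`. -/
theorem tendsto_posterior_compl {n : ℕ} {P₀ : Measure (Param n)} [IsProbabilityMeasure P₀]
    {i : Fin n} {ai : ℝ} (hP₀ : IsStubbornPrior P₀ i ai) (A : EuclideanSpace ℝ (Fin n))
    {S : Matrix (Fin n) (Fin n) ℝ} (hS : S.PosDef) {q : ℕ → EuclideanSpace ℝ (Fin n)}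
    (hq : Tendsto (empiricalMoments q) atTop (𝓝 (A, S))) {B : Set (Param n)} (hB : IsOpen B)
    (hmem : limitParam A hS i ai ∈ B) :
    Tendsto (fun t => posterior P₀ q t Bᶜ) atTop (𝓝 0) := by
  have hF : IsClosed ({p : Param n | p.1 i = ai} ∩ Bᶜ) :=
    (isClosed_setOf_fst_apply_eq i ai).inter hB.isClosed_compl
  obtain ⟨c', hc', hgap⟩ := exists_gap_crossEntropy A hS hF fun p hp =>
    minCrossEntropy_lt_crossEntropy A hS hp.1 fun h => hp.2 (h ▸ hmem)
  obtain ⟨c, hc, hcc'⟩ := exists_between hc'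
  rw [← crossEntropy_limitParam A hS] at hc
  obtain ⟨U, hU, hpU, hUlt⟩ := exists_isOpen_forall_crossEntropy_lt hc
  have hUpos := measure_pos_of_limitParam_mem hP₀ A hS hU hpU
  set κ := n * Real.log (2 * Real.pi)
  have hbound : ∀ᶠ t : ℕ in atTop, posterior P₀ q t Bᶜ ≤
      ENNReal.ofReal (Real.exp (-(t * ((c' - c) / 2)))) / P₀ U := by
    filter_upwards [eventually_ne_atTop 0, hq.eventually hUlt,
      hq.eventually (eventually_forall_lt_crossEntropy A hS hF hgap)] with t ht h1 h2
    have hsplit : Real.exp (-(t / 2) * (κ + c')) =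
        Real.exp (-(t / 2) * (κ + c)) * Real.exp (-(t * ((c' - c) / 2))) := by
      rw [← Real.exp_add]; congr 1; ring
    calc posterior P₀ q t Bᶜ
        ≤ ENNReal.ofReal (Real.exp (-(t / 2) * (κ + c'))) /
            (ENNReal.ofReal (Real.exp (-(t / 2) * (κ + c))) * P₀ U) :=
          ENNReal.div_le_div (lintegral_likelihood_le hP₀ q ht hB.measurableSet.compl h2)
            (le_lintegral_likelihood P₀ q ht hU.measurableSet h1)
      _ = _ := by
          rw [hsplit, ENNReal.ofReal_mul (Real.exp_pos _).le]
          exact ENNReal.mul_div_mul_left _ _ (ENNReal.ofReal_pos.2 (Real.exp_pos _)).ne'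
            ENNReal.ofReal_ne_top
  have hlim : Tendsto (fun t : ℕ => ENNReal.ofReal (Real.exp (-(t * ((c' - c) / 2)))) / P₀ U)
      atTop (𝓝 0) := by
    have h1 : Tendsto (fun t : ℕ => Real.exp (-(t * ((c' - c) / 2)))) atTop (𝓝 0) :=
      Real.tendsto_exp_neg_atTop_nhds_zero.comp
        (tendsto_natCast_atTop_atTop.atTop_mul_const (by linarith))
    have h2 := ENNReal.Tendsto.div_const (ENNReal.tendsto_ofReal h1)
      (b := P₀ U) (Or.inr hUpos.ne')
    rwa [ENNReal.ofReal_zero, ENNReal.zero_div] at h2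
  exact tendsto_of_tendsto_of_tendsto_of_le_of_le' tendsto_const_nhds hlim
    (Eventually.of_forall fun _ => zero_le) hbound

theorem beliefsConcentrateOn_iff {n : ℕ} {P₀ : Measure (Param n)} [IsProbabilityMeasure P₀]
    {i : Fin n} {ai : ℝ} (hP₀ : IsStubbornPrior P₀ i ai) (A : EuclideanSpace ℝ (Fin n))
    {S : Matrix (Fin n) (Fin n) ℝ} (hS : S.PosDef) {q : ℕ → EuclideanSpace ℝ (Fin n)}
    (hq : Tendsto (empiricalMoments q) atTop (𝓝 (A, S))) (p : Param n) :
    BeliefsConcentrateOn P₀ q p ↔ p = limitParam A hS i ai := by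
  constructor
  · intro h
    by_contra hne
    -- Disjoint neighbourhoods cannot both have posterior mass tending to `1`.
    obtain ⟨B', B, hB', hB, hpB', hpB, hdisj⟩ := t2_separation hne
    have h0 := tendsto_posterior_compl hP₀ A hS hq hB hpB
    have h1 : (1 : ℝ≥0∞) ≤ 0 := le_of_tendsto_of_tendsto' (h B' hB' hpB') h0 fun t =>
      ENNReal.div_le_div_right (lintegral_mono_set hdisj.subset_compl_right) _
    simp at h1
  · rintro rfl B hB hmem
    have h0 := ENNReal.Tendsto.sub (tendsto_const_nhds (x := (1 : ℝ≥0∞)))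
      (tendsto_posterior_compl hP₀ A hS hq hB hmem) (Or.inl ENNReal.one_ne_top)
    rw [tsub_zero] at h0
    refine h0.congr' ?_
    filter_upwards [eventually_lintegral_likelihood hP₀ A hS hq] with t ht
    have hadd : posterior P₀ q t B + posterior P₀ q t Bᶜ = 1 := by
      rw [posterior, posterior, ENNReal.div_add_div_same,
        lintegral_add_compl _ hB.measurableSet, ENNReal.div_self ht.1 ht.2]
    have hfin : posterior P₀ q t Bᶜ ≠ ∞ :=
      ((le_add_self.trans hadd.le).trans_lt ENNReal.one_lt_top).ne
    rw [← hadd, ENNReal.add_sub_cancel_right hfin]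

end SocialBeliefs

theorem proposition2 {n : ℕ} (i : Fin n)
    {Ω : Type*} [MeasurableSpace Ω] (μ : Measure Ω) [IsProbabilityMeasure μ]
    (A : EuclideanSpace ℝ (Fin n))
    (S : Matrix (Fin n) (Fin n) ℝ) (hS : S.PosDef)
    (ε : ℕ → Ω → EuclideanSpace ℝ (Fin n))
    (hε_law : ∀ t, HasLaw (ε t) (multivariateGaussian 0 S) μ)
    (hε_indep : iIndepFun ε μ)
    (ai : ℝ) (hai : A i < ai)
    (P₀ : Measure (SocialBeliefs.Param n)) [IsProbabilityMeasure P₀]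
    (hP₀ : SocialBeliefs.IsStubbornPrior P₀ i ai) :
    ∃ p : SocialBeliefs.Param n,
      (∀ᵐ ω ∂μ, ∀ p' : SocialBeliefs.Param n,
        SocialBeliefs.BeliefsConcentrateOn P₀
          (fun t => SocialBeliefs.recognition A (ε t ω)) p' ↔ p' = p) ∧
      (∀ j, p.1 j - A j = S i j / S i i * (ai - A i)) ∧
      (∀ j j', p.2.1 j j' - S j j' = (p.1 j - A j) * (p.1 j' - A j') ∧
        (p.1 j - A j) * (p.1 j' - A j') =
          S j' i * S j i / S i i ^ 2 * (ai - A i) ^ 2) := by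
  have hfst : ∀ j, (SocialBeliefs.limitParam A hS i ai).1 j - A j =
      S i j / S i i * (ai - A i) := fun j => by
    simp [SocialBeliefs.limitParam, SocialBeliefs.limitBias]
  have hsymm : ∀ j, S i j = S j i := fun j => by simpa using hS.1.apply j i
  refine ⟨SocialBeliefs.limitParam A hS i ai, ?_, hfst, fun j j' => ⟨?_, ?_⟩⟩
  · filter_upwards [SocialBeliefs.tendsto_empiricalMoments A hS.posSemidef hε_law hε_indep]
      with ω hω p'
    exact SocialBeliefs.beliefsConcentrateOn_iff hP₀ A hS hω p'
  · rw [hfst, hfst]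
    simp [SocialBeliefs.limitParam, SocialBeliefs.limitBias, Matrix.vecMulVec_apply]
  · rw [hfst, hfst, hsymm j, hsymm j']
    ring
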